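/- There is an absolute constant $C$ such that the following holds. Let $\delta\ge 1$ be an integer and let $G$ be a finite, simple, connected, $3$-colorable graph of order $n$ in which every vertex has degree at least $\delta$. Then $$\operatorname{diam}(G)\le \frac{5n}{2\delta}+C.$$ In particular, this holds when $\delta\geq 1$ is the minimum degree of $G$. -/

import Mathlib

/-!
The bound holds with `C = 0`, by fractional packing: if `y : V → ℕ` has total mass `M` and the
neighbourhood of every vertex carries mass at most `K`, then counting the pairs (vertex, neighbour)
with weight `y` in two ways gives `δ * M ≤ K * n`.

Let `D` be the diameter and split `V` into the distance layers `L 0, …, L D` from an endpoint of a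
diametral path; edges stay within a layer or join consecutive layers. The packing is a sum of `D`
pieces of mass `24`, one on each `L i ∪ L (i + 1)`, and every neighbourhood carries at most `60`,
so `24 * D * δ ≤ 60 * n`. The piece on `L i ∪ L (i + 1)` (`exists_isPiece`) is chosen as follows.

* If only two colours occur, the ends of an edge between the two layers get `12` each.
* If all three colours occur and one of the layers is monochromatic, a vertex of this layer gets
  `10` and two vertices of the other layer, of the two remaining colours, get `7` each.
* If all three colours occur and neither layer is monochromatic, there are a trichromatic triple
  with one vertex in `L i` and two in `L (i + 1)`, and another one with two in `L i` and one in
  `L (i + 1)`; every member of each triple gets `4`.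

A vertex is never adjacent to a vertex of its own colour, so a vertex of `L j` receives at most `17`
from the piece on `L (j - 1) ∪ L j`, and at most `16` unless `L (j - 1)` is monochromatic; it
receives at most `14` from the piece on `L (j - 2) ∪ L (j - 1)`, and at most `12` if `L (j - 1)` is
monochromatic. Either way the pieces on the left contribute at most `30`, and so do those on the
right by symmetry.
-/

namespace LayerPacking

variable {V : Type*} [Fintype V] (G : SimpleGraph V) [DecidableRel G.Adj]

/-! ### Loads and weak duality -/

/-- The mass which `y` puts on the neighbourhood of `v`. -/
def load (y : V → ℕ) (v : V) : ℕ := ∑ u, if G.Adj v u then y u else 0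

lemma load_zero (v : V) : load G 0 v = 0 := by simp [load]

lemma load_add (y z : V → ℕ) (v : V) : load G (y + z) v = load G y v + load G z v := by
  simp only [load, ← Finset.sum_add_distrib, Pi.add_apply]
  refine Finset.sum_congr rfl fun u _ => ?_
  split_ifs <;> rfl

lemma load_single [DecidableEq V] (p : V) (a : ℕ) (v : V) :
    load G (Pi.single p a) v = a * if G.Adj v p then 1 else 0 := by
  rw [load, Finset.sum_eq_single p]
  · simp
  · intro u _ hu
    simp [hu]
  · simp

lemma load_sum (s : Finset ℕ) (y : ℕ → V → ℕ) (v : V) :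
    load G (∑ i ∈ s, y i) v = ∑ i ∈ s, load G (y i) v := by
  classical
  induction s using Finset.induction_on with
  | empty => simp [load_zero]
  | insert a s ha ih => rw [Finset.sum_insert ha, Finset.sum_insert ha, load_add, ih]

/-- Weak duality between fractional packings and the minimum degree condition. -/
lemma minDegree_mul_sum_le (y : V → ℕ) (K : ℕ) (hK : ∀ v, load G y v ≤ K) :
    G.minDegree * ∑ v, y v ≤ K * Fintype.card V := by
  calc G.minDegree * ∑ u, y u = ∑ u, G.minDegree * y u := Finset.mul_sum _ _ _
    _ ≤ ∑ u, G.degree u * y u :=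
      Finset.sum_le_sum fun u _ => Nat.mul_le_mul_right _ (G.minDegree_le_degree u)
    _ = ∑ u, ∑ v, if G.Adj v u then y u else 0 := by
      refine Finset.sum_congr rfl fun u _ => ?_
      rw [← Finset.sum_filter, Finset.sum_const, smul_eq_mul, ← G.card_neighborFinset_eq_degree,
        G.neighborFinset_eq_filter]
      simp only [G.adj_comm]
    _ = ∑ v, load G y v := Finset.sum_comm
    _ ≤ ∑ _v : V, K := Finset.sum_le_sum fun v _ => hK v
    _ = K * Fintype.card V := by simp [mul_comm]

/-! ### Pieces on two consecutive layers -/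

/-- Layer `i` of the layering `h` is monochromatic in the colouring `c`. -/
def Mono (h c : V → ℕ) (i : ℕ) : Prop := ∀ u v, h u = i → h v = i → c u = c v

/-- The bounds on the load of the piece `y` placed on the layers `i` and `i + 1`. They are arranged
so that the two pieces on either side of a vertex together load it with at most `30`. -/
structure IsPiece (h c : V → ℕ) (i : ℕ) (y : V → ℕ) : Prop where
  far : ∀ v, h v + 1 < i ∨ i + 2 < h v → load G y v = 0
  outer_left : ∀ v, h v + 1 = i → load G y v ≤ 14 ∧ (Mono h c i → load G y v ≤ 12)
  outer_right : ∀ v, h v = i + 2 → load G y v ≤ 14 ∧ (Mono h c (i + 1) → load G y v ≤ 12)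
  inner_left : ∀ v, h v = i → load G y v ≤ 17 ∧ (¬ Mono h c (i + 1) → load G y v ≤ 16)
  inner_right : ∀ v, h v = i + 1 → load G y v ≤ 17 ∧ (¬ Mono h c i → load G y v ≤ 16)

lemma isPiece_zero (h c : V → ℕ) (i : ℕ) : IsPiece G h c i 0 := by
  constructor <;> simp [load_zero]

variable {G}

omit [Fintype V] [DecidableRel G.Adj] in
lemma exists_triple {h c : V → ℕ} (hc : ∀ v, c v < 3) {k l : ℕ} (hk : ¬ Mono h c k)
    {p : V} (hp : h p = l) (hall : ∀ t < 3, ∃ w, c w = t ∧ (h w = l ∨ h w = k)) :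
    ∃ a b d, h a = l ∧ h b = k ∧ h d = k ∧ c a ≠ c b ∧ c a ≠ c d ∧ c b ≠ c d := by
  simp only [Mono, not_forall] at hk
  obtain ⟨u, v, hu, hv, huv⟩ := hk
  have h1 := hc u
  have h2 := hc v
  have h3 := hc p
  -- the colours are `0, 1, 2`, with sum `3`, so this is the colour other than those of `u` and `v`
  obtain ⟨w, hw, hwl⟩ := hall (3 - c u - c v) (by omega)
  rcases hwl with hwl | hwl
  · exact ⟨w, u, v, hwl, hu, hv, by omega, by omega, huv⟩
  -- layer `k` contains all three colours, and two of them differ from the colour of `p`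
  · by_cases hpu : c p = c u
    · exact ⟨p, v, w, hp, hv, hwl, by omega, by omega, by omega⟩
    · by_cases hpv : c p = c v
      · exact ⟨p, u, w, hp, hu, hwl, by omega, by omega, by omega⟩
      · exact ⟨p, u, v, hp, hu, hv, hpu, hpv, huv⟩

/-- Two layers joined by an edge carry a piece of mass `24`. The edge is only needed when no third
colour occurs; otherwise three colours suffice, adjacent or not. -/
lemma exists_isPiece {h c : V → ℕ} (hc : ∀ v, c v < 3)
    (hadj : ∀ u v, G.Adj u v → h u ≤ h v + 1 ∧ h v ≤ h u + 1 ∧ c u ≠ c v) {i : ℕ}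
    {p q : V} (hpq : G.Adj p q) (hp : h p = i) (hq : h q = i + 1) :
    ∃ y : V → ℕ, ∑ v, y v = 24 ∧ IsPiece G h c i y := by
  classical
  have hne := (hadj p q hpq).2.2
  have hcp := hc p
  have hcq := hc q
  -- `hadj` in terms of adjacency indicators, the form in which they enter the loads
  have key : ∀ v u, ((if G.Adj v u then 1 else 0) = 0) ∨
      ((if G.Adj v u then 1 else 0) = 1 ∧ h v ≤ h u + 1 ∧ h u ≤ h v + 1 ∧ c v ≠ c u) := by
    intro v u
    split_ifs with hvu
    · exact Or.inr ⟨rfl, hadj v u hvu⟩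
    · exact Or.inl rfl
  by_cases htwo : ∀ u, h u = i ∨ h u = i + 1 → c u = c p ∨ c u = c q
  -- a vertex of either layer shares its colour with `p` or `q`, hence misses one of them
  · refine ⟨Pi.single p 12 + Pi.single q 12, by simp [Finset.sum_add_distrib], ?_⟩
    constructor <;> intro v hv <;> simp only [load_add, load_single] <;>
      have h1 := key v p <;> have h2 := key v q <;> have h3 := htwo v <;>
      generalize (if G.Adj v p then 1 else 0) = x1 at * <;>
      generalize (if G.Adj v q then 1 else 0) = x2 at * <;>
      omega
  push Not at htwo
  obtain ⟨r, hr, hrp, hrq⟩ := htwo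
  have hcr := hc r
  have three : ∀ a b d : V, c a ≠ c b → c a ≠ c d → c b ≠ c d → ∀ v,
      c v = c a ∨ c v = c b ∨ c v = c d := by
    intro a b d h1 h2 h3 v
    have := hc a
    have := hc b
    have := hc d
    have := hc v
    omega
  by_cases hL : Mono h c i
  · have hr' : h r = i + 1 := hr.resolve_left fun hr => hrp (hL r p hr hp)
    have hR : ¬ Mono h c (i + 1) := fun hR => hrq (hR r q hr' hq)
    refine ⟨Pi.single p 10 + Pi.single q 7 + Pi.single r 7,
      by simp [Finset.sum_add_distrib], ?_⟩
    constructor <;> intro v hv <;> simp only [load_add, load_single] <;>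
      have h1 := key v p <;> have h2 := key v q <;> have h3 := key v r <;>
      have h4 := three p q r hne hrp.symm hrq.symm v <;> have h5 := hL v p <;>
      generalize (if G.Adj v p then 1 else 0) = x1 at * <;>
      generalize (if G.Adj v q then 1 else 0) = x2 at * <;>
      generalize (if G.Adj v r then 1 else 0) = x3 at * <;>
      (try simp only [hL, hR, not_true_eq_false, not_false_eq_true, true_imp_iff, false_imp_iff,
        and_true]) <;>
      omega
  by_cases hR : Mono h c (i + 1)
  · have hr' : h r = i := hr.resolve_right fun hr => hrq (hR r q hr hq)
    refine ⟨Pi.single q 10 + Pi.single p 7 + Pi.single r 7,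
      by simp [Finset.sum_add_distrib], ?_⟩
    constructor <;> intro v hv <;> simp only [load_add, load_single] <;>
      have h1 := key v p <;> have h2 := key v q <;> have h3 := key v r <;>
      have h4 := three p q r hne hrp.symm hrq.symm v <;> have h5 := hR v q <;>
      generalize (if G.Adj v p then 1 else 0) = x1 at * <;>
      generalize (if G.Adj v q then 1 else 0) = x2 at * <;>
      generalize (if G.Adj v r then 1 else 0) = x3 at * <;>
      (try simp only [hL, hR, not_true_eq_false, not_false_eq_true, true_imp_iff, false_imp_iff,
        and_true]) <;>
      omega
  have hall : ∀ t < 3, ∃ w, c w = t ∧ (h w = i ∨ h w = i + 1) := by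
    intro t ht
    by_cases h1 : c p = t
    · exact ⟨p, h1, Or.inl hp⟩
    by_cases h2 : c q = t
    · exact ⟨q, h2, Or.inr hq⟩
    · exact ⟨r, by omega, hr⟩
  obtain ⟨a, b, d, ha, hb, hd, hab, had, hbd⟩ := exists_triple hc hR hp hall
  obtain ⟨a', b', d', ha', hb', hd', hab', had', hbd'⟩ := exists_triple hc hL hq
    fun t ht => (hall t ht).imp fun w hw => ⟨hw.1, hw.2.symm⟩
  -- three bounds on the load of one triple: in general, away from the layer of `b` and `d`, and
  -- away from both layers
  have triple : ∀ (k l : ℕ) (a b d : V), h a = l → h b = k → h d = k →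
      c a ≠ c b → c a ≠ c d → c b ≠ c d → ∀ v,
      load G (Pi.single a 4 + Pi.single b 4 + Pi.single d 4) v ≤ 8 ∧
      (h v + 1 < k ∨ k + 1 < h v →
        load G (Pi.single a 4 + Pi.single b 4 + Pi.single d 4) v ≤ 4 ∧
        (h v + 1 < l ∨ l + 1 < h v →
          load G (Pi.single a 4 + Pi.single b 4 + Pi.single d 4) v = 0)) := by
    intro k l a b d ha hb hd h1 h2 h3 v
    simp only [load_add, load_single]
    have := three a b d h1 h2 h3 v
    have := key v a
    have := key v b
    have := key v d
    generalize (if G.Adj v a then 1 else 0) = x1 at *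
    generalize (if G.Adj v b then 1 else 0) = x2 at *
    generalize (if G.Adj v d then 1 else 0) = x3 at *
    refine ⟨by omega, fun hk => ⟨by omega, fun hl => by omega⟩⟩
  refine ⟨(Pi.single a 4 + Pi.single b 4 + Pi.single d 4) +
    (Pi.single a' 4 + Pi.single b' 4 + Pi.single d' 4), by simp [Finset.sum_add_distrib], ?_⟩
  have t1 := triple _ _ a b d ha hb hd hab had hbd
  have t2 := triple _ _ a' b' d' ha' hb' hd' hab' had' hbd'
  clear triple key three hall hadj
  constructor <;> intro v hv <;> rw [load_add] <;> specialize t1 v <;> specialize t2 v <;>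
    (try simp only [hL, hR, not_false_eq_true, true_imp_iff, false_imp_iff, and_true]) <;>
    omega

/-! ### The sum of the pieces -/

/-- The pieces overlap little: only those on the layers `j - 2, …, j + 2` load a vertex of layer
`j`, and each side contributes at most `30`. -/
lemma sum_load_le {h c : V → ℕ} {y : ℕ → V → ℕ} (hy : ∀ i, IsPiece G h c i (y i)) (D : ℕ) (v : V) :
    ∑ i ∈ Finset.range D, load G (y i) v ≤ 60 := by
  have hleft : ∑ i ∈ Finset.range (h v), load G (y i) v ≤ 30 := by
    rcases hj : h v with _ | _ | j
    · simp
    · have := ((hy 0).inner_right v hj).1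
      simp only [zero_add, Finset.sum_range_one]
      omega
    · rw [Finset.sum_range_succ, Finset.sum_range_succ, Finset.sum_eq_zero fun i hi =>
        (hy i).far v (Or.inr (by have := Finset.mem_range.1 hi; omega))]
      have h1 := (hy j).outer_right v hj
      have h2 := (hy (j + 1)).inner_right v hj
      by_cases hm : Mono h c (j + 1)
      · have := h1.2 hm
        omega
      · have := h2.2 hm
        omega
  have hright : ∑ i ∈ Finset.range D, load G (y (h v + i)) v ≤ 30 := by
    have hfar : ∀ i, 2 ≤ i → load G (y (h v + i)) v = 0 :=
      fun i hi => (hy _).far v (Or.inl (by omega))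
    calc ∑ i ∈ Finset.range D, load G (y (h v + i)) v
        ≤ ∑ i ∈ Finset.range (D + 2), load G (y (h v + i)) v :=
          Finset.sum_le_sum_of_subset (Finset.range_mono (by omega))
      _ = ∑ i ∈ Finset.range 2, load G (y (h v + i)) v := by
          rw [add_comm D 2, Finset.sum_range_add, Finset.sum_eq_zero (s := Finset.range D)
            fun i _ => hfar _ (by omega), add_zero]
      _ ≤ 30 := by
          simp only [Finset.sum_range_succ, Finset.sum_range_zero, zero_add, add_zero]
          have h1 := (hy (h v + 1)).outer_left v rfl
          have h2 := (hy (h v)).inner_left v rfl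
          by_cases hm : Mono h c (h v + 1)
          · have := h1.2 hm
            omega
          · have := h2.2 hm
            omega
  calc ∑ i ∈ Finset.range D, load G (y i) v
      ≤ ∑ i ∈ Finset.range (h v + D), load G (y i) v :=
        Finset.sum_le_sum_of_subset (Finset.range_mono (by omega))
    _ ≤ 60 := by
        rw [Finset.sum_range_add]
        omega

/-- The diameter bound in integer form, without an additive constant. -/
theorem two_mul_minDegree_mul_diam_le (hG : G.Connected) (hcol : G.Colorable 3) :
    2 * (G.minDegree * G.diam) ≤ 5 * Fintype.card V := by
  classical
  have := hG.nonempty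
  obtain ⟨C⟩ := hcol
  obtain ⟨x, z, hxz⟩ := G.exists_dist_eq_diam
  have hadj : ∀ u v, G.Adj u v → G.dist x u ≤ G.dist x v + 1 ∧ G.dist x v ≤ G.dist x u + 1 ∧
      (C u : ℕ) ≠ C v := by
    intro u v huv
    have h1 := hG.dist_triangle (u := x) (v := u) (w := v)
    have h2 := hG.dist_triangle (u := x) (v := v) (w := u)
    rw [SimpleGraph.dist_eq_one_iff_adj.2 huv] at h1
    rw [SimpleGraph.dist_eq_one_iff_adj.2 huv.symm] at h2
    exact ⟨h2, h1, fun h => C.valid huv (Fin.ext h)⟩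
  have hpiece : ∀ i, ∃ y : V → ℕ, (i < G.diam → ∑ v, y v = 24) ∧
      IsPiece G (G.dist x) (fun v => (C v : ℕ)) i y := by
    intro i
    by_cases hi : i < G.diam
    · obtain ⟨w⟩ := hG.preconnected x z
      -- the walk leaves the ball of radius `i` around `x` along an edge between layers
      obtain ⟨d, -, hd1, hd2⟩ := w.exists_boundary_dart {v | G.dist x v ≤ i} (by simp)
        (by simp only [Set.mem_ofPred_eq]; omega)
      simp only [Set.mem_ofPred_eq] at hd1 hd2
      have h1 := hadj _ _ d.adj
      obtain ⟨y, hy, hy'⟩ := exists_isPiece (G := G) (h := G.dist x) (c := fun v => (C v : ℕ))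
        (fun v => (C v).isLt) hadj (i := i) d.adj (by omega) (by omega)
      exact ⟨y, fun _ => hy, hy'⟩
    · exact ⟨0, fun h => absurd h hi, isPiece_zero G _ _ _⟩
  choose y hy hy' using hpiece
  have hmass : ∑ v, (∑ i ∈ Finset.range G.diam, y i) v = G.diam * 24 := by
    simp only [Finset.sum_apply]
    rw [Finset.sum_comm, Finset.sum_congr rfl fun i hi => hy i (Finset.mem_range.1 hi)]
    simp
  have := minDegree_mul_sum_le G (∑ i ∈ Finset.range G.diam, y i) 60 fun v => by
    rw [load_sum]
    exact sum_load_le hy' _ v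
  rw [hmass, ← mul_assoc] at this
  omega

end LayerPacking

theorem mainTheorem7 :
    ∃ C : ℝ, ∀ (V : Type*) [Fintype V] (G : SimpleGraph V) [DecidableRel G.Adj] (δ : ℕ),
      1 ≤ δ → G.Connected → G.Colorable 3 → δ ≤ G.minDegree →
        (G.diam : ℝ) ≤ 5 * (Fintype.card V : ℝ) / (2 * (δ : ℝ)) + C := by
  refine ⟨0, fun V _ G _ δ hδ hG hcol hmin => ?_⟩
  have h := LayerPacking.two_mul_minDegree_mul_diam_le hG hcol
  have h' : 2 * (δ * G.diam) ≤ 5 * Fintype.card V :=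
    le_trans (Nat.mul_le_mul_left _ (Nat.mul_le_mul_right _ hmin)) h
  have hpos : (0 : ℝ) < δ := by exact_mod_cast hδ
  rw [add_zero, le_div_iff₀ (by positivity)]
  have h'' : (2 * (δ * G.diam) : ℝ) ≤ 5 * Fintype.card V := by exact_mod_cast h'
  linarith
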